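/- Conventions. Graphs are finite and simple. For $t\ge 0$ a graph $G$ is $t$-tough if $t\cdot\omega(G-X)\le|X|$ for every $X\subseteq V(G)$ with $\omega(G-X)>1$, where $\omega$ is the number of connected components. An $n$-sequence is an integer sequence $d_1\le\dots\le d_n$ with $0\le d_j\le n-1$; $\pi'$ majorizes $\pi$ if $d'_j\ge d_j$ for all $j$. A sequence is graphical (a degree sequence) if it consists of the vertex degrees of some graph, called a realization of it. For a property $P$ of graphs, a graphical sequence is forcibly $P$ if all its realizations have $P$. A Chvátal-type condition for $n$-sequences is a condition $d_{i_1}\ge k_{i_1}\vee\dots\vee d_{i_r}\ge k_{i_r}$ with integers $r\ge 1$, $1\le i_1<\dots<i_r\le n$ and $1\le k_{i_1}\le\dots\le k_{i_r}\le n$. It is $P$-weakly-optimal if every $n$-sequence (graphical or not) that violates it is majorized by a degree sequence which is not forcibly $P$. A finite set of Chvátal-type conditions gives the criterion that declares an $n$-sequence to be forcibly $P$ exactly when the sequence satisfies all the conditions. Such a criterion is a $P$-theorem if every degree sequence that it declares forcibly $P$ is forcibly $P$; it is monotone if, for degree sequences $\pi,\pi'$ such that $\pi'$ majorizes $\pi$,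 it declares $\pi'$ whenever it declares $\pi$; it is weakly optimal if every $n$-sequence (graphical or not) that it does not declare is majorized by a degree sequence which is not forcibly $P$. A best monotone $P$-theorem is a monotone and weakly optimal $P$-theorem. The $P$-subposet is the set of degree sequences of those $n$-vertex graphs without $P$ that are edge-maximal with respect to not having $P$, ordered by majorization; its maximal elements are called sinks. Let $p(r)$ denote the number of partitions of the integer $r$. **Theorem.** Let $k\ge 2$ and $m\ge 9$ be integers, and let $n=m(k+1)$. Then: 1. every best monotone $1/k$-tough theorem for $n$-sequences whose conditions are all ($1/k$-tough)-weakly-optimal Chvátal-type conditions contains at least $\dfrac{p(k-1)\,n}{5(k+1)}$ such conditions; 2. the number of sinks of the ($1/k$-tough)-subposet, for graphs on $n$ vertices, is at least $\dfrac{p(k-1)\,n}{5(k+1)}$. -/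

import Mathlib

/-- A nondecreasing `n`-sequence `d_1 ≤ ... ≤ d_n` of integers with `0 ≤ d_j ≤ n - 1`: a monotone map
`Fin n → Fin n`, where the position `j` is stored as `j - 1`. The pointwise order `π ≤ π'` on these
maps is the relation "`π'` majorizes `π`". -/
abbrev NSeq (n : ℕ) : Type := Fin n →o Fin n

/-- A property of graphs on `n` (labelled) vertices. -/
abbrev GraphProperty (n : ℕ) : Type := SimpleGraph (Fin n) → Prop

open Classical in
/-- `G` is a realization of `π`: the vertex degrees of `G`, listed in a suitable order, are the
entries of `π`. -/
def IsRealization {n : ℕ} (G : SimpleGraph (Fin n)) (π : NSeq n) : Prop :=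
  ∃ σ : Equiv.Perm (Fin n), ∀ i : Fin n, G.degree (σ i) = (π i : ℕ)

/-- `π` is graphical, i.e. it is a degree sequence of some graph. -/
def IsGraphical {n : ℕ} (π : NSeq n) : Prop :=
  ∃ G : SimpleGraph (Fin n), IsRealization G π

/-- `π` is forcibly `P`: it is graphical and each of its realizations has property `P`. -/
def IsForcibly {n : ℕ} (P : GraphProperty n) (π : NSeq n) : Prop :=
  IsGraphical π ∧ ∀ G : SimpleGraph (Fin n), IsRealization G π → P G

/-- `π` is majorized by a degree sequence which is not forcibly `P`. -/
def IsMajorizedByNonForcibly {n : ℕ} (P : GraphProperty n) (π : NSeq n) : Prop :=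
  ∃ π' : NSeq n, π ≤ π' ∧ IsGraphical π' ∧ ¬ IsForcibly P π'

/-- The number `ω(G - X)` of connected components of the graph obtained by deleting `X`. -/
noncomputable def numComponentsDelete {V : Type*} (G : SimpleGraph V) (X : Finset V) : ℕ :=
  Nat.card (G.induce ((X : Set V)ᶜ)).ConnectedComponent

/-- `G` is `t`-tough: `t * ω(G - X) ≤ |X|` for every `X ⊆ V(G)` with `ω(G - X) > 1`. -/
def IsTough {V : Type*} (t : ℝ) (G : SimpleGraph V) : Prop :=
  ∀ X : Finset V, 1 < numComponentsDelete G X →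
    t * (numComponentsDelete G X : ℝ) ≤ (X.card : ℝ)

/-- A Chvátal-type condition `d_{i_1} ≥ k_{i_1} ∨ ... ∨ d_{i_r} ≥ k_{i_r}` for `n`-sequences, where
`1 ≤ i_1 < ... < i_r ≤ n` and `1 ≤ k_{i_1} ≤ ... ≤ k_{i_r} ≤ n`. -/
structure ChvatalCondition (n : ℕ) where
  /-- the number of disjuncts -/
  r : ℕ
  r_pos : 0 < r
  /-- the positions `i_1 < ... < i_r` -/
  index : Fin r → Fin n
  index_strictMono : StrictMono index
  /-- the lower bounds `k_{i_1} ≤ ... ≤ k_{i_r}` -/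
  bound : Fin r → ℕ
  bound_monotone : Monotone bound
  one_le_bound : ∀ j, 1 ≤ bound j
  bound_le : ∀ j, bound j ≤ n

namespace ChvatalCondition

/-- The sequence `π` satisfies the condition `c`. -/
def Holds {n : ℕ} (c : ChvatalCondition n) (π : NSeq n) : Prop :=
  ∃ j : Fin c.r, c.bound j ≤ (π (c.index j) : ℕ)

/-- `c` is `P`-weakly-optimal: every sequence, graphical or not, which does not satisfy `c` is
majorized by a degree sequence which is not forcibly `P`. -/
def IsWeaklyOptimal {n : ℕ} (P : GraphProperty n) (c : ChvatalCondition n) : Prop :=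
  ∀ π : NSeq n, ¬ c.Holds π → IsMajorizedByNonForcibly P π

end ChvatalCondition

/-- A criterion on `n`-sequences, given by the set `T` of sequences that fulfil it, is a
`P`-theorem if every degree sequence in `T` is indeed forcibly `P`. -/
def IsPTheorem {n : ℕ} (P : GraphProperty n) (T : Set (NSeq n)) : Prop :=
  ∀ π ∈ T, IsGraphical π → IsForcibly P π

/-- A criterion `T` is monotone if, for degree sequences `π ≤ π'`, whenever it declares `π`
forcibly `P` it also declares `π'` forcibly `P`. -/
def IsMonotoneCriterion {n : ℕ} (T : Set (NSeq n)) : Prop :=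
  ∀ π π' : NSeq n, IsGraphical π → IsGraphical π' → π ≤ π' → π ∈ T → π' ∈ T

/-- A criterion `T` is weakly optimal for `P` if every sequence, graphical or not, outside `T` is
majorized by a degree sequence which is not forcibly `P`. -/
def IsWeaklyOptimalCriterion {n : ℕ} (P : GraphProperty n) (T : Set (NSeq n)) : Prop :=
  ∀ π : NSeq n, π ∉ T → IsMajorizedByNonForcibly P π

/-- A best monotone `P`-theorem: a `P`-theorem which is both monotone and weakly optimal. -/
def IsBestMonotonePTheorem {n : ℕ} (P : GraphProperty n) (T : Set (NSeq n)) : Prop :=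
  IsPTheorem P T ∧ IsMonotoneCriterion T ∧ IsWeaklyOptimalCriterion P T

/-- The criterion whose hypothesis is the conjunction of the conditions in `S`. -/
def criterionOf {n : ℕ} (S : Finset (ChvatalCondition n)) : Set (NSeq n) :=
  {π | ∀ c ∈ S, c.Holds π}

/-- The `P`-subposet: the degree sequences of the graphs on `n` vertices which are edge-maximal
among the graphs without property `P`. -/
def propertySubposet {n : ℕ} (P : GraphProperty n) : Set (NSeq n) :=
  {π | ∃ G : SimpleGraph (Fin n), Maximal (fun H => ¬ P H) G ∧ IsRealization G π}

/-- The sinks: the maximal elements, with respect to majorization, of the `P`-subposet. -/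
def sinks {n : ℕ} (P : GraphProperty n) : Set (NSeq n) :=
  {π | Maximal (fun ρ => ρ ∈ propertySubposet P) π}

/-- The integer partition function `p(r)`. -/
def partitionNumber (r : ℕ) : ℕ := Fintype.card (Nat.Partition r)

/-! A weakly optimal condition is violated by at most one sink: if it fails for sinks π and π', it
fails for their pointwise maximum, so one member of the subposet majorizes both, and both equal it.
In a `P`-theorem every sink violates some condition, so there are at least as many conditions as
sinks (`ncard_sinks_le_card`).

It remains to exhibit `(m - 2) * p(k - 1)` sinks. For `1 ≤ j ≤ m - 2` and a partition of `k - 1`,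
join `K_j` to `k * j + 1` disjoint cliques: one big clique, and `k * j` small ones whose orders
minus one are the parts, padded with zeros. Deleting `K_j` shows that the graph is not `1/k`-tough.
No other non-`1/k`-tough graph has a strictly larger degree sequence (`eq_of_le_of_not_isTough`),
and the sequence determines `j` and the partition (`exists_sink_family`). -/

/-! ### Components of a vertex-deleted graph as colour classes. -/

/-- `κ` splits the vertices outside `X` into nonempty colour classes without edges between them. -/
def IsSeparatingColoring {V ι : Type*} (G : SimpleGraph V) (X : Finset V) (κ : V → ι) : Prop :=
  (∀ c, ∃ v, v ∉ X ∧ κ v = c) ∧ ∀ u v, u ∉ X → v ∉ X → G.Adj u v → κ u = κ v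

theorem exists_isSeparatingColoring {V : Type*} [Nonempty V] (G : SimpleGraph V) (X : Finset V)
    (h : 1 < numComponentsDelete G X) :
    ∃ κ : V → (G.induce ((X : Set V)ᶜ)).ConnectedComponent, IsSeparatingColoring G X κ := by
  classical
  have hne : Nonempty (G.induce ((X : Set V)ᶜ)).ConnectedComponent := by
    by_contra hcon
    rw [not_nonempty_iff] at hcon
    simp [numComponentsDelete] at h
  -- Colours on `X` are irrelevant, hence the arbitrary default.
  refine ⟨fun v => if hv : v ∈ ((X : Set V)ᶜ) then
    (G.induce ((X : Set V)ᶜ)).connectedComponentMk ⟨v, hv⟩ else hne.some, ?_, ?_⟩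
  · intro c
    induction c using SimpleGraph.ConnectedComponent.ind with
    | h v =>
      obtain ⟨v, hv⟩ := v
      exact ⟨v, by simpa using hv, by simp only [hv, dif_pos]⟩
  · intro u v hu hv huv
    have hu' : u ∈ ((X : Set V)ᶜ) := by simpa using hu
    have hv' : v ∈ ((X : Set V)ᶜ) := by simpa using hv
    simp only [hu', hv', dif_pos]
    rw [SimpleGraph.ConnectedComponent.eq]
    exact SimpleGraph.Adj.reachable (by simpa using huv)

theorem IsSeparatingColoring.card_le {V ι : Type*} [Finite V] {G : SimpleGraph V} {X : Finset V}
    {κ : V → ι} (h : IsSeparatingColoring G X κ) :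
    Nat.card ι ≤ numComponentsDelete G X := by
  have key : ∀ u v : ((X : Set V)ᶜ : Set V), (G.induce ((X : Set V)ᶜ)).Reachable u v →
      κ u = κ v := by
    rintro u v ⟨p⟩
    induction p with
    | nil => rfl
    | @cons a b c hab _ ih =>
      exact (h.2 a b a.2 b.2 (by simpa using hab)).trans ih
  let φ : (G.induce ((X : Set V)ᶜ)).ConnectedComponent → ι :=
    SimpleGraph.ConnectedComponent.lift (fun v => κ v) (fun u v p _ => key u v ⟨p⟩)
  refine Nat.card_le_card_of_surjective φ fun c => ?_
  obtain ⟨v, hv, rfl⟩ := h.1 c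
  exact ⟨(G.induce ((X : Set V)ᶜ)).connectedComponentMk ⟨v, by simpa using hv⟩, rfl⟩

section classes

variable {V ι : Type*} [Fintype V] [DecidableEq V] [DecidableEq ι]

/-- The colour class, outside `X`, of colour `c`. -/
def colorClass (X : Finset V) (κ : V → ι) (c : ι) : Finset V := {u ∈ Xᶜ | κ u = c}

theorem IsSeparatingColoring.colorClass_card_pos {G : SimpleGraph V} {X : Finset V} {κ : V → ι}
    (h : IsSeparatingColoring G X κ) (c : ι) : 0 < (colorClass X κ c).card := by
  obtain ⟨v, hv, hc⟩ := h.1 c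
  exact Finset.card_pos.2 ⟨v, by simp [colorClass, hv, hc]⟩

theorem IsSeparatingColoring.degree_succ_le {G : SimpleGraph V} [DecidableRel G.Adj]
    {X : Finset V} {κ : V → ι}
    (h : IsSeparatingColoring G X κ) {v : V} (hv : v ∉ X) :
    G.degree v + 1 ≤ X.card + (colorClass X κ (κ v)).card := by
  rw [← SimpleGraph.card_neighborFinset_eq_degree,
    ← Finset.card_insert_of_notMem (G.notMem_neighborFinset_self v)]
  refine (Finset.card_le_card ?_).trans (Finset.card_union_le _ _)
  intro u hu
  rw [Finset.mem_insert, SimpleGraph.mem_neighborFinset] at hu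
  by_cases hX : u ∈ X
  · exact Finset.mem_union_left _ hX
  · refine Finset.mem_union_right _ ?_
    rcases hu with rfl | hu
    · simp [colorClass, hX]
    · simp [colorClass, hX, h.2 v u hv hX hu]

theorem sum_colorClass_card [Fintype ι] (X : Finset V) (κ : V → ι) :
    ∑ c, (colorClass X κ c).card = Fintype.card V - X.card := by
  rw [← Finset.card_compl]
  exact (Finset.card_eq_sum_card_fiberwise fun _ _ => Finset.mem_coe.2 (Finset.mem_univ _)).symm

theorem IsSeparatingColoring.class_add_card_le [Fintype ι] {G : SimpleGraph V} {X : Finset V}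
    {κ : V → ι} (h : IsSeparatingColoring G X κ) (c : ι) :
    (colorClass X κ c).card + Fintype.card ι ≤ Fintype.card V - X.card + 1 := by
  rw [← sum_colorClass_card X κ, ← Finset.add_sum_erase _ _ (Finset.mem_univ c)]
  have h1 : (Finset.univ.erase c).card • 1 ≤
      ∑ x ∈ Finset.univ.erase c, (colorClass X κ x).card :=
    Finset.card_nsmul_le_sum _ _ _ fun x _ => h.colorClass_card_pos x
  have h2 : 0 < Fintype.card ι := Fintype.card_pos_iff.2 ⟨c⟩
  rw [Finset.card_erase_of_mem (Finset.mem_univ c), Finset.card_univ] at h1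
  simp only [smul_eq_mul, mul_one] at h1
  omega

/-- Each class of order `c` contributes `c` terms `1/c`. -/
theorem IsSeparatingColoring.sum_inv_card [Fintype ι] {G : SimpleGraph V} {X : Finset V}
    {κ : V → ι} (h : IsSeparatingColoring G X κ) :
    ∑ v ∈ Xᶜ, ((colorClass X κ (κ v)).card : ℝ)⁻¹ = Fintype.card ι := by
  rw [← Finset.sum_fiberwise Xᶜ κ]
  have : ∀ c : ι, ∑ v ∈ Xᶜ with κ v = c, ((colorClass X κ (κ v)).card : ℝ)⁻¹ = 1 := by
    intro c
    have h0 : ((colorClass X κ c).card : ℝ) ≠ 0 := by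
      exact_mod_cast (h.colorClass_card_pos c).ne'
    rw [Finset.sum_congr rfl (g := fun _ => ((colorClass X κ c).card : ℝ)⁻¹)
      (fun v hv => by rw [(Finset.mem_filter.1 hv).2])]
    rw [Finset.sum_const, nsmul_eq_mul]
    exact mul_inv_cancel₀ h0
  simp [this]

end classes

/-! ### Degree sequences, majorization and sinks. -/

theorem not_isTough_iff {V : Type*} {k : ℕ} (hk : 0 < k) (G : SimpleGraph V) :
    ¬ IsTough (1 / (k : ℝ)) G ↔
      ∃ X : Finset V, 1 < numComponentsDelete G X ∧ k * X.card < numComponentsDelete G X := by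
  have hk' : (0 : ℝ) < k := by exact_mod_cast hk
  simp only [IsTough, not_forall, not_le, exists_prop]
  refine exists_congr fun X => and_congr_right fun _ => ?_
  rw [one_div, inv_mul_eq_div, lt_div_iff₀ hk', mul_comm]
  exact_mod_cast Iff.rfl

theorem exists_realized {n : ℕ} (G : SimpleGraph (Fin n)) : ∃ π : NSeq n, IsRealization G π := by
  classical
  let d : Fin n → Fin n := fun v => ⟨G.degree v, by
    have := G.degree_lt_card_verts v
    rwa [Fintype.card_fin] at this⟩
  refine ⟨⟨d ∘ Tuple.sort d, Tuple.monotone_sort d⟩, Tuple.sort d, fun i => ?_⟩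
  simp only [OrderHom.coe_mk, Function.comp_apply, d]

theorem IsRealization.sum_eq {n : ℕ} {G : SimpleGraph (Fin n)} [DecidableRel G.Adj] {π : NSeq n}
    (h : IsRealization G π) {M : Type*} [AddCommMonoid M] (g : ℕ → M) :
    ∑ i, g (π i) = ∑ v, g (G.degree v) := by
  obtain ⟨σ, hσ⟩ := h
  rw [← Equiv.sum_comp σ (fun v => g (G.degree v))]
  refine Finset.sum_congr rfl fun i _ => congrArg g ?_
  rw [← hσ]
  congr!

theorem le_of_le_comp_perm {n : ℕ} {f g : NSeq n} (σ : Equiv.Perm (Fin n))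
    (h : ∀ i, f i ≤ g (σ i)) : f ≤ g := by
  intro i
  -- Pigeonhole: otherwise `σ` would inject `Ici i` into the smaller set `Ioi i`.
  obtain ⟨i', hi', hσ⟩ : ∃ i', i ≤ i' ∧ σ i' ≤ i := by
    by_contra! hcon
    have := Finset.card_le_card_of_injOn (s := Finset.Ici i) (t := Finset.Ioi i) σ
      (fun x hx => by simpa using hcon x (by simpa using hx)) σ.injective.injOn
    rw [Fin.card_Ici, Fin.card_Ioi] at this
    omega
  exact (f.monotone hi').trans ((h i').trans (g.monotone hσ))

theorem IsRealization.le_of_le {n : ℕ} {G H : SimpleGraph (Fin n)} {π ρ : NSeq n}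
    (hG : IsRealization G π) (hH : IsRealization H ρ) (h : G ≤ H) : π ≤ ρ := by
  classical
  obtain ⟨σ, hσ⟩ := hG
  obtain ⟨τ, hτ⟩ := hH
  refine le_of_le_comp_perm (σ.trans τ.symm) fun i => ?_
  rw [Fin.le_def, ← hσ, ← hτ]
  rw [Equiv.trans_apply, Equiv.apply_symm_apply]
  exact SimpleGraph.degree_le_of_le h

/-- A sequence that is maximal among the degree sequences of graphs without `P` is a sink. -/
theorem mem_sinks_of_maximal {n : ℕ} {P : GraphProperty n} {π : NSeq n}
    (G : SimpleGraph (Fin n)) (hG : ¬ P G) (hπ : IsRealization G π)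
    (hmax : ∀ (H : SimpleGraph (Fin n)) (ρ : NSeq n), ¬ P H → IsRealization H ρ → π ≤ ρ → ρ = π) :
    π ∈ sinks P := by
  obtain ⟨H, hGH, hH⟩ := Finite.exists_le_maximal (p := fun H => ¬ P H) hG
  obtain ⟨ρ, hρ⟩ := exists_realized H
  have : ρ = π := hmax H ρ hH.prop hρ (hπ.le_of_le hρ hGH)
  refine ⟨⟨H, hH, this ▸ hρ⟩, ?_⟩
  rintro τ ⟨K, hK, hτ⟩ hle
  exact (hmax K τ hK.prop hτ hle).le

theorem exists_mem_propertySubposet_ge {n : ℕ} {P : GraphProperty n} {π : NSeq n}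
    (h : IsMajorizedByNonForcibly P π) : ∃ ρ ∈ propertySubposet P, π ≤ ρ := by
  obtain ⟨π', hle, hgr, hnf⟩ := h
  have : ∃ G, IsRealization G π' ∧ ¬ P G := by
    by_contra! hcon
    exact hnf ⟨hgr, hcon⟩
  obtain ⟨G, hG, hP⟩ := this
  obtain ⟨H, hGH, hH⟩ := Finite.exists_le_maximal (p := fun H => ¬ P H) hP
  obtain ⟨ρ, hρ⟩ := exists_realized H
  exact ⟨ρ, ⟨H, hH, hρ⟩, hle.trans (hG.le_of_le hρ hGH)⟩

theorem ncard_sinks_le_card {n : ℕ} {P : GraphProperty n} {S : Finset (ChvatalCondition n)}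
    (hS : ∀ c ∈ S, c.IsWeaklyOptimal P) (hT : IsPTheorem P (criterionOf S)) :
    (sinks P).ncard ≤ S.card := by
  classical
  have hviol : ∀ π ∈ sinks P, ∃ c ∈ S, ¬ c.Holds π := by
    rintro π ⟨⟨G, hG, hπ⟩, -⟩
    by_contra! hcon
    exact hG.prop ((hT π hcon ⟨G, hπ⟩).2 G hπ)
  rcases (sinks P).eq_empty_or_nonempty with h0 | ⟨π₀, h0⟩
  · simp [h0]
  have : Nonempty (ChvatalCondition n) := ⟨(hviol π₀ h0).choose⟩
  choose! φ hφ hφv using hviol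
  rw [← Set.ncard_coe_finset S]
  refine Set.ncard_le_ncard_of_injOn φ (fun π hπ => hφ π hπ) ?_ (Set.toFinite _)
  intro π hπ π' hπ' heq
  -- At each position the supremum takes the value of `π` or of `π'`, and both miss the bound there.
  have hsup : ¬ (φ π).Holds (π ⊔ π') := by
    rintro ⟨j, hj⟩
    rcases le_total (π ((φ π).index j)) (π' ((φ π).index j)) with h | h
    · refine hφv π' hπ' (heq ▸ ⟨j, ?_⟩)
      simpa [h] using hj
    · refine hφv π hπ ⟨j, ?_⟩
      simpa [h] using hj
  obtain ⟨ρ, hρ, hle⟩ := exists_mem_propertySubposet_ge (hS _ (hφ π hπ) _ hsup)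
  have h1 := hπ.eq_of_le hρ (le_sup_left.trans hle)
  have h2 := hπ'.eq_of_le hρ (le_sup_right.trans hle)
  exact h1.trans h2.symm

/-! ### Weights that certify a sink. -/

/-- The weight of a vertex of degree `d` in a graph with a cut set of size `j`. -/
noncomputable def cutWeight (j d : ℕ) : ℝ := ((d - j + 1 : ℕ) : ℝ)⁻¹

theorem cutWeight_anti (j : ℕ) {d e : ℕ} (h : d ≤ e) : cutWeight j e ≤ cutWeight j d := by
  unfold cutWeight
  gcongr

theorem cutWeight_inj {j d e : ℕ} (hd : j ≤ d) (he : j ≤ e) (h : cutWeight j d = cutWeight j e) :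
    d = e := by
  unfold cutWeight at h
  have := inv_injective h
  have : d - j + 1 = e - j + 1 := by exact_mod_cast this
  omega

/-- A criterion for a sequence not to be strictly majorized by the degree sequence of a graph that
is not `1/k`-tough. -/
theorem eq_of_le_of_not_isTough {n k j m : ℕ} (hk : 0 < k) (hn : n = m * (k + 1)) (hj : j < m)
    {π : NSeq n}
    (hlow : ∀ i, j ≤ (π i : ℕ))
    (htop : j ≤ ∑ i, if n - 1 ≤ (π i : ℕ) then 1 else 0)
    (hbig : n - k * (j + 1) < ∑ i, if n - k * (j + 1) ≤ (π i : ℕ) then 1 else 0)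
    (hsum : ∑ i, cutWeight j (π i) ≤ (k * j + 1 : ℕ) + j * cutWeight j (n - 1))
    {H : SimpleGraph (Fin n)} {ρ : NSeq n} (hH : ¬ IsTough (1 / (k : ℝ)) H)
    (hρ : IsRealization H ρ) (hle : π ≤ ρ) : ρ = π := by
  classical
  obtain ⟨X, hX1, hXk⟩ := (not_isTough_iff hk H).1 hH
  have hn0 : 0 < n := by rw [hn]; exact Nat.mul_pos (by omega) (by omega)
  have : Nonempty (Fin n) := ⟨⟨0, hn0⟩⟩
  obtain ⟨κ, hκ⟩ := exists_isSeparatingColoring H X hX1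
  have : Fintype (H.induce ((X : Set (Fin n))ᶜ)).ConnectedComponent := Fintype.ofFinite _
  set w := numComponentsDelete H X with hw
  have hcard : Fintype.card (H.induce ((X : Set (Fin n))ᶜ)).ConnectedComponent = w := by
    rw [hw, numComponentsDelete, Nat.card_eq_fintype_card]
  have hXn : X.card ≤ n := by simpa using X.card_le_univ
  have hclass := hκ.class_add_card_le
  have hdeg := fun v hv => hκ.degree_succ_le (v := v) hv
  simp only [Fintype.card_fin, hcard] at hclass
  have hmono : ∀ D, (∑ i, if D ≤ (π i : ℕ) then 1 else 0) ≤
      ({v | D ≤ H.degree v} : Finset (Fin n)).card := by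
    intro D
    rw [Finset.card_filter, ← hρ.sum_eq (fun d => if D ≤ d then 1 else 0)]
    refine Finset.sum_le_sum fun i _ => ?_
    have : (π i : ℕ) ≤ ρ i := hle i
    split_ifs <;> omega
  rcases lt_trichotomy X.card j with hlt | heq | hgt
  -- Fewer than `j` deleted vertices: some vertex outside `X` is adjacent to all others, so one
  -- component remains.
  · exfalso
    obtain ⟨v, hv, hvX⟩ := Finset.exists_mem_notMem_of_card_lt_card
      (hlt.trans_le (htop.trans (hmono (n - 1))))
    have h1 := (Finset.mem_filter.1 hv).2
    have h2 := hdeg v hvX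
    have h3 := hclass (κ v)
    omega
  -- Exactly `j` deleted vertices: a vertex in a component of order `c` has degree at most `j + c -
  -- 1`, hence weight at least `1/c`, so the weights outside `X` sum to at least the number of
  -- components. As weights decrease with the degree, the upper bound `hsum` forces equality entry
  -- by entry.
  · have hge : (k * j + 1 : ℕ) + j * cutWeight j (n - 1) ≤ ∑ i, cutWeight j (ρ i) := by
      rw [hρ.sum_eq (cutWeight j), ← Finset.sum_add_sum_compl X, add_comm]
      refine add_le_add ?_ ?_
      · rw [← heq, ← nsmul_eq_mul]
        refine Finset.card_nsmul_le_sum _ _ _ fun v _ => cutWeight_anti _ ?_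
        have := H.degree_lt_card_verts v
        rw [Fintype.card_fin] at this
        omega
      · calc ((k * j + 1 : ℕ) : ℝ) ≤ w := by rw [← heq]; exact_mod_cast hXk
          _ = ∑ v ∈ Xᶜ, ((colorClass X κ (κ v)).card : ℝ)⁻¹ := by rw [hκ.sum_inv_card, hcard]
          _ ≤ _ := by
            refine Finset.sum_le_sum fun v hv => ?_
            have h2 := hdeg v (Finset.mem_compl.1 hv)
            -- Covers degrees below `j`, where the truncated difference in `cutWeight` is zero.
            have h3 := hκ.colorClass_card_pos (κ v)
            unfold cutWeight
            gcongr
            omega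
    have hterm : ∀ i ∈ Finset.univ, cutWeight j (ρ i) ≤ cutWeight j (π i) :=
      fun i _ => cutWeight_anti j (hle i)
    have heqs := (Finset.sum_eq_sum_iff_of_le hterm).1
      (le_antisymm (Finset.sum_le_sum hterm) (hsum.trans hge))
    ext i
    exact cutWeight_inj ((hlow i).trans (hle i)) (hlow i) (heqs i (Finset.mem_univ i))
  -- More than `j` deleted vertices: the other components leave too little room, so degrees outside
  -- `X` are below `n - k * (j + 1)`; by `hbig`, more than `X.card` vertices reach that degree.
  · exfalso
    have hX0 : ∀ c, k * X.card + 1 ≤ n - X.card := fun c => by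
      have h3 := hclass c
      have h4 := hκ.colorClass_card_pos c
      omega
    have hXm : X.card < m := by
      have h0 := hX0 (κ ⟨0, hn0⟩)
      by_contra! hcon
      have : m * (k + 1) ≤ X.card * (k + 1) := Nat.mul_le_mul_right _ hcon
      rw [← hn] at this
      have h5 : X.card * (k + 1) = k * X.card + X.card := by ring
      omega
    have h6 : k * (j + 1) + X.card ≤ n := by
      have h7 : k * (j + 1) ≤ k * m := Nat.mul_le_mul_left _ hj
      have h8 : n = k * m + m := by rw [hn]; ring
      omega
    have h9 : k * (j + 1) ≤ k * X.card := Nat.mul_le_mul_left _ hgt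
    obtain ⟨v, hv, hvX⟩ := Finset.exists_mem_notMem_of_card_lt_card
      ((show X.card < _ by omega).trans_le (hmono (n - k * (j + 1))))
    have h1 := (Finset.mem_filter.1 hv).2
    have h2 := hdeg v hvX
    have h3 := hclass (κ v)
    omega

/-! ### The extremal graphs: a clique joined to disjoint cliques. -/

/-- The join of the clique on the vertices coloured `none` with the disjoint union of the cliques
on the remaining colour classes. -/
def cliqueJoin {V ι : Type*} (κ : V → Option ι) : SimpleGraph V where
  Adj u v := u ≠ v ∧ (κ u = none ∨ κ v = none ∨ κ u = κ v)
  symm := ⟨fun u v h => ⟨h.1.symm, by rcases h.2 with h | h | h <;> simp [h]⟩⟩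
  loopless := ⟨fun u h => h.1 rfl⟩

section cliqueJoin

variable {V ι : Type*} [Fintype V] (κ : V → Option ι)

theorem degree_cliqueJoin_of_eq_none [DecidableEq V] [DecidableEq ι]
    [DecidableRel (cliqueJoin κ).Adj] {v : V}
    (h : κ v = none) : (cliqueJoin κ).degree v = Fintype.card V - 1 := by
  rw [← SimpleGraph.card_neighborFinset_eq_degree, ← Finset.card_univ,
    ← Finset.card_erase_of_mem (Finset.mem_univ v)]
  congr 1
  ext u
  rw [SimpleGraph.mem_neighborFinset]
  simp [cliqueJoin, h, eq_comm]

theorem degree_cliqueJoin_of_eq_some [DecidableEq V] [DecidableEq ι]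
    [DecidableRel (cliqueJoin κ).Adj] {v : V} {c : ι}
    (h : κ v = some c) : (cliqueJoin κ).degree v =
      ({u | κ u = none} : Finset V).card + ({u | κ u = some c} : Finset V).card - 1 := by
  have hd : Disjoint ({u | κ u = none} : Finset V) ({u | κ u = some c} : Finset V) :=
    Finset.disjoint_left.2 fun u hu hu' => by simp_all
  rw [← SimpleGraph.card_neighborFinset_eq_degree, ← Finset.card_union_of_disjoint hd,
    ← Finset.card_erase_of_mem (a := v) (by simp [h])]
  congr 1
  ext u
  rw [SimpleGraph.mem_neighborFinset]
  simp [cliqueJoin, h, eq_comm]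

theorem card_le_numComponentsDelete_cliqueJoin [Nonempty ι] (hκ : ∀ c, ∃ v, κ v = some c) :
    Nat.card ι ≤ numComponentsDelete (cliqueJoin κ) {u | κ u = none} := by
  refine IsSeparatingColoring.card_le (κ := fun v => (κ v).getD (Classical.arbitrary ι)) ⟨?_, ?_⟩
  · intro c
    obtain ⟨v, hv⟩ := hκ c
    exact ⟨v, by simp [hv], by simp [hv]⟩
  · intro u v hu hv huv
    simp only [Finset.mem_filter, Finset.mem_univ, true_and] at hu hv
    have := huv.2
    simp_all

end cliqueJoin

open Classical in
theorem exists_coloring_with_class_sizes {n j : ℕ} (M : Multiset ℕ) (hsum : j + M.sum = n) :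
    ∃ κ : Fin n → Option M, ({u | κ u = none} : Finset (Fin n)).card = j ∧
      ∀ c : M, ({u | κ u = some c} : Finset (Fin n)).card = c.1 := by
  have hcard : Fintype.card (Fin n) = Fintype.card (Fin j ⊕ (Σ x : M, Fin x.1)) := by
    simp [← hsum, Multiset.sum_eq_sum_coe]
  let e := Fintype.equivOfCardEq hcard
  let col : Fin j ⊕ (Σ x : M, Fin x.1) → Option M := Sum.elim (fun _ => none) (fun p => some p.1)
  have hfib : ∀ o, ({u | col (e u) = o} : Finset (Fin n)).card =
      ({w | col w = o} : Finset (Fin j ⊕ (Σ x : M, Fin x.1))).card := fun o => by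
    simp only [Finset.card_filter]
    exact Equiv.sum_comp e (fun w => if col w = o then 1 else 0)
  refine ⟨fun u => col (e u), ?_, fun c => ?_⟩
  · rw [hfib, Finset.card_filter, Fintype.sum_sum_type, Fintype.sum_sigma]
    simp [col]
  · rw [hfib, Finset.card_filter, Fintype.sum_sum_type, Fintype.sum_sigma]
    simp [col]

/-- A graph obtained by joining a clique of order `j` to a disjoint union of cliques with orders
in `M`. -/
theorem exists_graph_of_clique_sizes {n j : ℕ} (M : Multiset ℕ) (hM : M ≠ 0)
    (hpos : ∀ c ∈ M, 0 < c) (hsum : j + M.sum = n) :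
    ∃ (G : SimpleGraph (Fin n)) (π : NSeq n) (X : Finset (Fin n)), IsRealization G π ∧
      X.card = j ∧ M.card ≤ numComponentsDelete G X ∧
      -- The sequence is described only through sums over its entries: indicators over `ℕ` count
      -- degrees, and `g = cutWeight j` over `ℝ` gives the total weight.
      ∀ (R : Type) [CommSemiring R] (g : ℕ → R), ∑ i, g (π i) =
        j * g (n - 1) + (M.map fun c : ℕ => (c : R) * g (j + c - 1)).sum := by
  classical
  obtain ⟨κ, h0, hc⟩ := exists_coloring_with_class_sizes M hsum
  obtain ⟨π, hπ⟩ := exists_realized (cliqueJoin κ)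
  obtain ⟨a, ha⟩ := Multiset.exists_mem_of_ne_zero hM
  have : Nonempty M := ⟨M.mkToType a ⟨0, Multiset.count_pos.2 ha⟩⟩
  refine ⟨cliqueJoin κ, π, ({u | κ u = none} : Finset (Fin n)), hπ, h0, ?_, ?_⟩
  · rw [← Multiset.card_coe, ← Nat.card_eq_fintype_card]
    refine card_le_numComponentsDelete_cliqueJoin κ fun c => ?_
    have := hpos c.1 Multiset.coe_mem
    rw [← hc c, Finset.card_pos] at this
    obtain ⟨v, hv⟩ := this
    exact ⟨v, by simpa using hv⟩
  · intro R _ g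
    rw [hπ.sum_eq g, ← Finset.sum_fiberwise Finset.univ κ, Fintype.sum_option,
      ← Multiset.map_univ M]
    congr 1
    · rw [Finset.sum_congr rfl (g := fun _ => g (n - 1)) fun v hv => by
        rw [degree_cliqueJoin_of_eq_none κ (Finset.mem_filter.1 hv).2, Fintype.card_fin],
        Finset.sum_const, h0, nsmul_eq_mul]
    · refine Finset.sum_congr rfl fun c _ => ?_
      rw [Finset.sum_congr rfl (g := fun _ => g (j + c.1 - 1)) fun v hv => by
        rw [degree_cliqueJoin_of_eq_some κ (Finset.mem_filter.1 hv).2, h0, hc],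
        Finset.sum_const, hc, nsmul_eq_mul]

/-- The orders of the cliques: one more than the parts of the partition, then as many ones as
needed to get `q` cliques, and a clique of order `b`. -/
def cliqueSizes {r : ℕ} (q b : ℕ) (p : Nat.Partition r) : Multiset ℕ :=
  b ::ₘ (p.parts.map (· + 1) + Multiset.replicate (q - p.parts.card) 1)

theorem card_parts_le {r : ℕ} (p : Nat.Partition r) : p.parts.card ≤ r := by
  have := Multiset.card_nsmul_le_sum (s := p.parts) (a := 1) fun x hx => p.parts_pos hx
  simpa [p.parts_sum] using this

theorem sum_cliqueSizes {r q b : ℕ} (p : Nat.Partition r) (h : r ≤ q) :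
    (cliqueSizes q b p).sum = b + r + q := by
  have := card_parts_le p
  simp [cliqueSizes, Multiset.sum_map_add, p.parts_sum]
  omega

theorem card_cliqueSizes {r q b : ℕ} (p : Nat.Partition r) (h : r ≤ q) :
    (cliqueSizes q b p).card = q + 1 := by
  have := card_parts_le p
  simp [cliqueSizes]
  omega

theorem pos_of_mem_cliqueSizes {r q b c : ℕ} {p : Nat.Partition r} (hb : 0 < b)
    (hc : c ∈ cliqueSizes q b p) : 0 < c := by
  simp only [cliqueSizes, Multiset.mem_cons, Multiset.mem_add, Multiset.mem_map,
    Multiset.mem_replicate] at hc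
  rcases hc with rfl | ⟨a, -, rfl⟩ | ⟨-, rfl⟩ <;> omega

/-- The order of the big clique makes the orders add up to `n`; its vertices have degree exactly `n
- k * (j + 1)`. With the `j` joined vertices they number one more than that degree, as `hbig`
demands. -/
theorem exists_sink {k j m n : ℕ} (hk : 2 ≤ k) (hj : 1 ≤ j) (hjm : j + 2 ≤ m)
    (hn : n = m * (k + 1)) (p : Nat.Partition (k - 1)) :
    ∃ π ∈ sinks (IsTough (1 / (k : ℝ)) : GraphProperty n),
      ∀ (R : Type) [CommSemiring R] (g : ℕ → R), ∑ i, g (π i) =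
        j * g (n - 1) + ((cliqueSizes (k * j) (n - k * (j + 1) + 1 - j) p).map
          fun c : ℕ => (c : R) * g (j + c - 1)).sum := by
  obtain ⟨s, rfl⟩ := Nat.exists_eq_add_of_le hjm
  set b := n - k * (j + 1) + 1 - j with hb
  have hn' : n = k * (j + 1) + k * s + k + j + 2 + s := by rw [hn]; ring
  have hbk : b = k * s + k + s + 3 := by omega
  have hkj : k * (j + 1) = k * j + k := by ring
  have hkj' : k - 1 ≤ k * j := (Nat.sub_le _ _).trans (Nat.le_mul_of_pos_right _ hj)
  have hsum := sum_cliqueSizes (b := b) p hkj'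
  have hcard := card_cliqueSizes (b := b) p hkj'
  have hpos : ∀ c ∈ cliqueSizes (k * j) b p, 0 < c := fun c hc =>
    pos_of_mem_cliqueSizes (by omega) hc
  obtain ⟨G, π, X, hG, hX, hω, hg⟩ := exists_graph_of_clique_sizes (n := n) (j := j)
    (cliqueSizes (k * j) b p) (Multiset.cons_ne_zero) hpos (by omega)
  have hlow : ∀ i, j ≤ (π i : ℕ) := by
    have h0 := hg ℕ fun d => if d < j then 1 else 0
    have h1 : ((cliqueSizes (k * j) b p).map fun c => ((c : ℕ) : ℕ) *
        (if j + c - 1 < j then 1 else 0)).sum = 0 := by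
      refine Multiset.sum_eq_zero fun x hx => ?_
      obtain ⟨c, hc, rfl⟩ := Multiset.mem_map.1 hx
      have := hpos c hc
      rw [if_neg (by omega), mul_zero]
    simp only [Nat.cast_id] at h0
    rw [h1, if_neg (by omega), mul_zero, add_zero, Finset.sum_eq_zero_iff] at h0
    intro i
    have := h0 i (Finset.mem_univ i)
    by_contra! hcon
    simp [hcon] at this
  refine ⟨π, mem_sinks_of_maximal G ?_ hG ?_, hg⟩
  · refine (not_isTough_iff (by omega) G).2 ⟨X, ?_, ?_⟩
    · have : 0 < k * j := by positivity
      omega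
    · rw [hX]; omega
  · intro H ρ hH hρ hle
    refine eq_of_le_of_not_isTough (by omega) hn (by omega : j < j + 2 + s) hlow ?_ ?_ ?_ hH hρ hle
    · rw [hg ℕ fun d => if n - 1 ≤ d then 1 else 0]
      simp
    · rw [hg ℕ fun d => if n - k * (j + 1) ≤ d then 1 else 0, cliqueSizes, Multiset.map_cons,
        Multiset.sum_cons, if_pos (by omega), if_pos (by omega)]
      simp only [Nat.cast_id, mul_one]
      omega
    · rw [hg ℝ (cutWeight j), add_comm]
      refine add_le_add_left ?_ _
      -- A clique of order `c` has `c` vertices of weight `1/c`, so each clique has weight 1.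
      rw [Multiset.map_congr rfl (g := fun _ => (1 : ℝ)) fun c hc => ?_]
      · simp [hcard, add_comm]
      · have := hpos c hc
        rw [cutWeight, show j + c - 1 - j + 1 = c by omega]
        exact mul_inv_cancel₀ (by exact_mod_cast this.ne')

/-! ### Distinctness of the sinks and the final count. -/

theorem sum_map_succ_mul_ite (s : Multiset ℕ) (a : ℕ) :
    (s.map fun x => (x + 1) * if x = a then 1 else 0).sum = (a + 1) * s.count a := by
  induction s using Multiset.induction with
  | empty => simp
  | cons x s ih =>
    rw [Multiset.map_cons, Multiset.sum_cons, ih, Multiset.count_cons]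
    by_cases h : x = a
    · subst h; simp; ring
    · simp [h, Ne.symm h]

theorem exists_sink_family {k m n : ℕ} (hk : 2 ≤ k) (hn : n = m * (k + 1)) :
    ∃ Φ : Fin (m - 2) × Nat.Partition (k - 1) → NSeq n, Function.Injective Φ ∧
      ∀ x, Φ x ∈ sinks (IsTough (1 / (k : ℝ)) : GraphProperty n) := by
  choose Φ hΦ hg using fun x : Fin (m - 2) × Nat.Partition (k - 1) =>
    -- The shift makes the cut sizes run over `1, ..., m - 2`.
    exists_sink (j := x.1 + 1) hk (by omega) (by omega) hn x.2
  refine ⟨Φ, ?_, hΦ⟩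
  have harith : ∀ j < m - 2, n = k * (j + 1 + 1) + k * (m - 3 - j) + k + m := by
    intro j hj
    obtain ⟨s, hs⟩ := Nat.exists_eq_add_of_lt hj
    obtain rfl : m = j + s + 3 := by omega
    rw [hn, show j + s + 3 - 3 - j = s by omega]
    ring
  -- Only the joined vertices have degree `n - 1`, so their number recovers the cut size.
  have hcount : ∀ (x : Fin (m - 2) × Nat.Partition (k - 1)),
      (∑ i, if n - 1 ≤ (Φ x i : ℕ) then 1 else 0) = (x.1 : ℕ) + 1 := by
    rintro ⟨⟨j, hj⟩, p⟩
    rw [hg ⟨⟨j, hj⟩, p⟩ ℕ fun d => if n - 1 ≤ d then 1 else 0]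
    have := harith j hj
    have hk' : k ≤ k * (j + 1 + 1) := Nat.le_mul_of_pos_right _ (by omega)
    simp only [Nat.cast_id, le_refl, if_true, mul_one]
    refine Nat.add_eq_left.2 (Multiset.sum_eq_zero fun x hx => ?_)
    obtain ⟨c, hc, rfl⟩ := Multiset.mem_map.1 hx
    simp only [cliqueSizes, Multiset.mem_cons, Multiset.mem_add, Multiset.mem_map,
      Multiset.mem_replicate] at hc
    rw [if_neg, mul_zero]
    rcases hc with rfl | ⟨a, ha, rfl⟩ | ⟨-, rfl⟩
    · omega
    · have := Multiset.le_sum_of_mem ha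
      rw [p.parts_sum] at this
      omega
    · omega
  -- Each part `a` gives a clique of `a + 1` vertices. The range `1 ≤ a < k` excludes isolated
  -- padding vertices and the big clique, whose order exceeds `k`.
  have hparts : ∀ (x : Fin (m - 2) × Nat.Partition (k - 1)) (a : ℕ), 1 ≤ a → a < k →
      (∑ i, if (Φ x i : ℕ) = (x.1 : ℕ) + 1 + a then 1 else 0) = (a + 1) * x.2.parts.count a := by
    rintro ⟨⟨j, hj⟩, p⟩ a ha hak
    have := harith j hj
    have hk' : k ≤ k * (j + 1 + 1) := Nat.le_mul_of_pos_right _ (by omega)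
    rw [hg ⟨⟨j, hj⟩, p⟩ ℕ fun d => if d = j + 1 + a then 1 else 0, ← sum_map_succ_mul_ite]
    simp only [Nat.cast_id, cliqueSizes, Multiset.map_cons, Multiset.sum_cons, Multiset.map_add,
      Multiset.sum_add, Multiset.map_map, Function.comp_apply, Multiset.map_replicate]
    rw [if_neg (by omega), if_neg (by omega), if_neg (by omega)]
    simp only [mul_zero, Multiset.sum_replicate, smul_zero, zero_add, add_zero]
    refine congrArg Multiset.sum (Multiset.map_congr rfl fun x _ => ?_)
    simp only [show j + 1 + (x + 1) - 1 = j + 1 + a ↔ x = a by omega]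
  rintro ⟨j, p⟩ ⟨j', p'⟩ h
  have hj : j = j' := by
    have h1 := hcount ⟨j, p⟩
    rw [h, hcount] at h1
    ext
    simpa using h1.symm
  subst hj
  refine Prod.ext rfl (Nat.Partition.ext (Multiset.ext.2 fun a => ?_))
  by_cases ha : 1 ≤ a ∧ a < k
  · have h1 := hparts ⟨j, p⟩ a ha.1 ha.2
    rw [h, hparts ⟨j, p'⟩ a ha.1 ha.2] at h1
    exact (Nat.eq_of_mul_eq_mul_left (Nat.succ_pos a) h1).symm
  · have key : ∀ q : Nat.Partition (k - 1), q.parts.count a = 0 := fun q => by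
      refine Multiset.count_eq_zero.2 fun hmem => ha ⟨q.parts_pos hmem, ?_⟩
      have := Multiset.le_sum_of_mem hmem
      rw [q.parts_sum] at this
      omega
    rw [key, key]

theorem theorem4p2 (k m n : ℕ) (hk : 2 ≤ k) (hm : 9 ≤ m) (hn : n = m * (k + 1)) :
    (∀ S : Finset (ChvatalCondition n),
      (∀ c ∈ S, c.IsWeaklyOptimal (IsTough (1 / (k : ℝ)))) →
      IsBestMonotonePTheorem (IsTough (1 / (k : ℝ))) (criterionOf S) →
      (partitionNumber (k - 1) : ℝ) * (n : ℝ) / (5 * ((k : ℝ) + 1)) ≤ (S.card : ℝ)) ∧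
    (partitionNumber (k - 1) : ℝ) * (n : ℝ) / (5 * ((k : ℝ) + 1)) ≤
      ((sinks (IsTough (1 / (k : ℝ)) : GraphProperty n)).ncard : ℝ) := by
  have hcast : (partitionNumber (k - 1) : ℝ) * (n : ℝ) / (5 * ((k : ℝ) + 1)) ≤
      ((sinks (IsTough (1 / (k : ℝ)) : GraphProperty n)).ncard : ℝ) := by
    obtain ⟨Φ, hinj, hΦ⟩ := exists_sink_family hk hn
    have : Finite (NSeq n) := DFunLike.finite _
    have h1 : (m - 2) * partitionNumber (k - 1) ≤
        (sinks (IsTough (1 / (k : ℝ)) : GraphProperty n)).ncard := by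
      rw [partitionNumber, ← Fintype.card_fin (m - 2), ← Fintype.card_prod,
        ← Nat.card_eq_fintype_card, ← Set.ncard_univ, ← Set.ncard_image_of_injective _ hinj]
      exact Set.ncard_le_ncard (by rintro _ ⟨x, -, rfl⟩; exact hΦ x) (Set.toFinite _)
    have h2 : (m : ℝ) / 5 ≤ (m - 2 : ℕ) := by
      have : (9 : ℝ) ≤ m := by exact_mod_cast hm
      rw [Nat.cast_sub (by omega)]
      push_cast
      linarith
    calc (partitionNumber (k - 1) : ℝ) * (n : ℝ) / (5 * ((k : ℝ) + 1))
        = (m : ℝ) / 5 * partitionNumber (k - 1) := by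
          rw [hn]; push_cast; field_simp
      _ ≤ (m - 2 : ℕ) * (partitionNumber (k - 1) : ℝ) := by gcongr
      _ ≤ _ := by exact_mod_cast h1
  refine ⟨fun S hS hT => hcast.trans ?_, hcast⟩
  exact_mod_cast ncard_sinks_le_card hS hT.1
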